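/- **The category of generalized simplices.** Let $\Delta$ be the category of finite ordinals $[n]=\Delta^n$ and let $\prod'_{n\ge 1}\Delta\subset\prod_{n\ge1}\Delta$ be the full subcategory on the sequences $S=(S_1,S_2,\dots)$ with only finitely many $S_n\neq\Delta^0$. The degree of a morphism $f$ is the least $k\ge 1$ such that $f_k$ is constant (factors through $\Delta^0$); write $f\sim g$ if $f$ and $g$ are parallel, have the same degree $d$, and $f_1=g_1,\dots,f_d=g_d$. This is a congruence. Let $\Theta$ be the full subcategory of $(\prod'\Delta)/{\sim}$ on the sequences $S$ with $S_n=\Delta^0$ for all $n>\dim S$, where $\dim S$ is the least $d\ge 0$ with $S_{d+1}=\Delta^0$. Write $\Theta^2:=(\Delta^2,\Delta^0,\Delta^0,\dots)\in\Theta$. Maps below are morphisms of presheaves of sets on $\Theta$. **The presheaf $\mathbf B^1G$.** For a group $G$, $\mathbf B^1G$ is the strict 1-groupoid with a single object, 1-morphisms the elements of $G$, and composition $g\circ h=gh$; that is, $(\mathbf B^1G)(S)$ is the set of $S_1$-simplices of the nerve of $G$. For $g,h\in G$ let $\sigma_{g,h}\in(\mathbf B^1G)(\Theta^2)$ be the simplex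 whose edge $0\to1$ is $h$, whose edge $1\to2$ is $g$, and whose edge $0\to2$ is $gh$. **The presheaf $\mathbf B^2A$.** For an abelian group $A$ and $S\in\Theta$ with $S_1=[a]$, $S_2=[b]$, an element of $(\mathbf B^2A)(S)$ is a string of $b$ composable morphisms in the groupoid whose objects are the normalized pseudofunctors from $[a]$ to the 2-category with one object, one 1-morphism and 2-morphisms $A$, and whose morphisms are the transformations with identity components on objects. Explicitly, it consists of elements $x^i_{pqr}\in A$ ($0\le i\le b$, $0\le p\le q\le r\le a$) and $c^{ij}_{pq}\in A$ ($0\le i\le j\le b$, $0\le p\le q\le a$) such that $$x^i_{ppr}=x^i_{prr}=0,\qquad x^i_{pqs}+x^i_{qrs}=x^i_{prs}+x^i_{pqr}\quad(p\le q\le r\le s),$$ $$c^{ij}_{pp}=0,\qquad c^{ii}_{pq}=0,\qquad c^{ik}_{pq}=c^{ij}_{pq}+c^{jk}_{pq},\qquad x^j_{pqr}+c^{ij}_{pq}+c^{ij}_{qr}=c^{ij}_{pr}+x^i_{pqr},$$ and morphisms of $\Theta$ act by reindexing along their first two components. Evaluation $y\mapsto x^0_{012}$ identifies $(\mathbf B^2A)(\Theta^2)$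 with $A$. **Proposition.** Let $G$ be a group and $A$ an abelian group. Sending a map $\varphi\colon\mathbf B^1G\to\mathbf B^2A$ to the function $$G\times G\to A,\qquad (g,h)\mapsto\varphi(\sigma_{g,h})\in(\mathbf B^2A)(\Theta^2)=A,$$ is a bijection from the set of maps $\mathbf B^1G\to\mathbf B^2A$ onto the set of normalized 2-cocycles $G\times G\to A$ (for the trivial action of $G$ on $A$), i.e. of the functions $f$ with $f(h,k)+f(g,hk)=f(gh,k)+f(g,h)$ and $f(1,g)=f(g,1)=0$ for all $g,h,k\in G$. -/

import Mathlib

open CategoryTheory Opposite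

universe u

namespace Cats

open Simplicial

/-! ### The category of generalized simplices

Components are indexed from `0`: the component `X n` here is the `(n + 1)`-st component
in the usual numbering by positive integers. -/

/-- Sequences of classical simplices. -/
abbrev DeltaSeq : Type := ℕ → SimplexCategory

/-- The restricted product `∏' Δ`: the full subcategory of the product category `∏ Δ` on the
sequences with only finitely many components different from `Δ⁰`. -/
abbrev RestrictedProd : Type :=
  ObjectProperty.FullSubcategory (C := DeltaSeq) (fun X => {n | X n ≠ ⦋0⦌}.Finite)

/-- A morphism of `Δ` is constant if it factors through `Δ⁰`. -/
def IsConst {a b : SimplexCategory} (f : a ⟶ b) : Prop :=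
  ∃ (p : a ⟶ ⦋0⦌) (q : ⦋0⦌ ⟶ b), f = p ≫ q

/-- `k` is the degree of `f` (with components numbered from `0`): the smallest index of a
constant component. -/
def IsDeg {X Y : RestrictedProd} (f : X ⟶ Y) (k : ℕ) : Prop :=
  IsLeast {k | IsConst (f.hom k)} k

/-- `f ∼ g` iff both have the same degree `d` and the same components up to and including
the `d`-th one. -/
def degRel : HomRel RestrictedProd := fun _ _ f g =>
  ∃ d, IsDeg f d ∧ IsDeg g d ∧ ∀ k ≤ d, f.hom k = g.hom k

/-- The dimension of a sequence: the number of components before the first `Δ⁰`. -/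
noncomputable def dim (X : RestrictedProd) : ℕ := sInf {d | X.obj d = ⦋0⦌}

/-- The category of generalized simplices: the full subcategory of `(∏' Δ)/∼` on the sequences
all of whose components beyond the dimension are `Δ⁰`. -/
abbrev GenSimplex : Type :=
  ObjectProperty.FullSubcategory (C := CategoryTheory.Quotient degRel)
    (fun X => ∀ n, dim X.as ≤ n → X.as.obj n = ⦋0⦌)

/-- The category `Set[⊵]` of presheaves of sets on generalized simplices. -/
abbrev GenSSet : Type (u + 1) := GenSimplexᵒᵖ ⥤ Type u

lemma IsConst.comp_left {a b c : SimplexCategory} (h : a ⟶ b) {f : b ⟶ c} (hf : IsConst f) :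
    IsConst (h ≫ f) := by
  obtain ⟨p, q, rfl⟩ := hf
  exact ⟨h ≫ p, q, by simp⟩

lemma IsConst.comp_right {a b c : SimplexCategory} {f : a ⟶ b} (hf : IsConst f) (h : b ⟶ c) :
    IsConst (f ≫ h) := by
  obtain ⟨p, q, rfl⟩ := hf
  exact ⟨p, q ≫ h, by simp⟩

lemma isConst_iff {a b : SimplexCategory} (f : a ⟶ b) :
    IsConst f ↔ ∀ p q, f.toOrderHom p = f.toOrderHom q := by
  constructor
  · rintro ⟨p, q, rfl⟩ i j
    have : p.toOrderHom i = p.toOrderHom j := Subsingleton.elim (α := Fin 1) _ _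
    simp [this]
  · intro h
    refine ⟨SimplexCategory.const _ ⦋0⦌ 0, SimplexCategory.const _ b (f.toOrderHom 0), ?_⟩
    ext i : 3
    simpa using! h i 0

lemma exists_isDeg {X Y : RestrictedProd} (f : X ⟶ Y) : ∃ d, IsDeg f d := by
  obtain ⟨n, hn⟩ := X.property.exists_notMem
  have hn : X.obj n = ⦋0⦌ := by simpa using hn
  have hne : {k | IsConst (f.hom k)}.Nonempty := by
    refine ⟨n, (isConst_iff _).2 ?_⟩
    have : Subsingleton (Fin ((X.obj n).len + 1)) := by
      rw [hn]
      exact inferInstanceAs (Subsingleton (Fin 1))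
    intro p q
    rw [Subsingleton.elim p q]
  exact ⟨_, Nat.sInf_mem hne, fun k hk => Nat.sInf_le hk⟩

lemma IsDeg.unique {X Y : RestrictedProd} {f : X ⟶ Y} {d e : ℕ} (h : IsDeg f d)
    (h' : IsDeg f e) : d = e :=
  IsLeast.unique h h'

/-- Agreement of `f` and `g` up to the degree of `f` is enough. -/
lemma degRel_of {X Y : RestrictedProd} {f g : X ⟶ Y} {d : ℕ} (hc : IsConst (f.hom d))
    (h : ∀ k ≤ d, f.hom k = g.hom k) : degRel f g := by
  obtain ⟨e, he⟩ := exists_isDeg f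
  have hed : e ≤ d := he.2 hc
  refine ⟨e, he, ⟨?_, ?_⟩, fun k hk => h k (hk.trans hed)⟩
  · have := he.1
    simpa [h e hed] using this
  · intro k hk
    by_contra hlt
    push Not at hlt
    have hk' : IsConst (g.hom k) := hk
    rw [← h k (hlt.le.trans hed)] at hk'
    exact absurd (he.2 hk') (by omega)

/-- The relation `∼` is an equivalence relation compatible with composition, so that the
morphisms of the quotient category are exactly its equivalence classes. -/
instance degRel_congruence : Congruence degRel where
  equivalence :=
    { refl := fun f => by
        obtain ⟨d, hd⟩ := exists_isDeg f
        exact ⟨d, hd, hd, fun _ _ => rfl⟩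
      symm := fun ⟨d, h₁, h₂, h⟩ => ⟨d, h₂, h₁, fun k hk => (h k hk).symm⟩
      trans := fun ⟨d, h₁, h₂, h⟩ ⟨e, h₃, h₄, h'⟩ => by
        obtain rfl := h₂.unique h₃
        exact ⟨d, h₁, h₄, fun k hk => (h k hk).trans (h' k hk)⟩ }
  comp_left f g g' := by
    rintro ⟨d, h₁, h₂, h⟩
    exact degRel_of (d := d) (h₁.1.comp_left (f.hom d)) fun k hk => by
      change f.hom k ≫ g.hom k = f.hom k ≫ g'.hom k
      rw [h k hk]
  comp_right {_ _ _ f f'} g := by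
    rintro ⟨d, h₁, h₂, h⟩
    exact degRel_of (d := d) (h₁.1.comp_right (g.hom d)) fun k hk => by
      change f.hom k ≫ g.hom k = f'.hom k ≫ g.hom k
      rw [h k hk]

/-- The generalized simplex `⊵ᵃ = (Δᵃ, Δ⁰, Δ⁰, …)`. -/
def simplex (a : ℕ) : GenSimplex where
  obj := ⟨{ obj := fun n => match n with
              | 0 => ⦋a⦌
              | _ + 1 => ⦋0⦌
            property := (Set.finite_singleton 0).subset (by
              rintro (_ | n) hn
              · rfl
              · exact absurd rfl hn) }⟩
  property := by
    have key : ∀ X : RestrictedProd, dim X ≤ 0 → X.obj 1 = ⦋0⦌ → X.obj 0 = ⦋0⦌ := by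
      intro X hX h1
      have h := Nat.sInf_mem (s := {d | X.obj d = ⦋0⦌}) ⟨1, h1⟩
      have h0 : sInf {d | X.obj d = ⦋0⦌} = 0 := Nat.le_zero.1 hX
      rwa [h0] at h
    rintro (_ | n) hn
    · exact key _ hn rfl
    · rfl

/-! ### The groupoid `𝐁¹ G` -/

/-- The projection `(A₁, A₂, …) ↦ A₁` from generalized to classical simplices. -/
def toDelta : GenSimplex ⥤ SimplexCategory :=
  ObjectProperty.ι _ ⋙ CategoryTheory.Quotient.lift degRel
    { obj := fun X => X.obj 0
      map := fun f => f.hom 0 }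
    (fun _ _ _ _ ⟨_, _, _, h⟩ => h 0 (Nat.zero_le _))

/-- The strict 1-groupoid `𝐁¹ G`: the classical nerve of the one-object groupoid with
morphisms `G` and composition `g ∘ h = g * h`, regarded as a presheaf on generalized simplices
by means of the projection to `Δ`. -/
def B1 (G : Type u) [Group G] : GenSSet.{u} :=
  toDelta.op ⋙ nerve (SingleObj G)

/-- The simplex `⊵² → 𝐁¹ G` formed by the composable pair of 1-morphisms `h`, then `g`,
with composite `g * h`. -/
def B1.pair {G : Type u} [Group G] (g h : G) : (B1 G).obj (op (simplex 2)) :=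
  ComposableArrows.mk₂ (C := SingleObj G) (X₀ := SingleObj.star G) (X₁ := SingleObj.star G)
    (X₂ := SingleObj.star G) h g

/-! ### The groupoid `𝐁² A` -/

/-- A simplex of `𝐁² A` of shape `(Δᵃ, Δᵇ, …)`: a string of `b` composable morphisms in the
groupoid whose objects are the normalized (pseudo)functors from the ordered set `[a]` to the
one-object, one-1-morphism 2-category with 2-morphisms `A`, and whose morphisms are the
transformations with identity components on objects.

The `i`-th functor is given by its compositors `x i p q r : A`, the 2-morphisms filling the
triangles `p ≤ q ≤ r`; the transformation from the `i`-th to the `j`-th functor is given by its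
2-morphisms `c i j p q : A` on the 1-morphisms `p ≤ q`. -/
@[ext]
structure Cell (A : Type u) [AddCommGroup A] (a b : ℕ) where
  x : Fin (b + 1) → ∀ p q r : Fin (a + 1), p ≤ q → q ≤ r → A
  c : ∀ i j : Fin (b + 1), i ≤ j → ∀ p q : Fin (a + 1), p ≤ q → A
  x_left : ∀ i p r (h : p ≤ r), x i p p r le_rfl h = 0
  x_right : ∀ i p r (h : p ≤ r), x i p r r h le_rfl = 0
  x_assoc : ∀ i p q r s (h₁ : p ≤ q) (h₂ : q ≤ r) (h₃ : r ≤ s),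
    x i p q s h₁ (h₂.trans h₃) + x i q r s h₂ h₃ =
      x i p r s (h₁.trans h₂) h₃ + x i p q r h₁ h₂
  c_unit : ∀ i j (h : i ≤ j) p, c i j h p p le_rfl = 0
  c_nat : ∀ i j (h : i ≤ j) p q r (h₁ : p ≤ q) (h₂ : q ≤ r),
    x j p q r h₁ h₂ + (c i j h p q h₁ + c i j h q r h₂) =
      c i j h p r (h₁.trans h₂) + x i p q r h₁ h₂
  c_refl : ∀ i p q (h : p ≤ q), c i i le_rfl p q h = 0
  c_comp : ∀ i j k (hij : i ≤ j) (hjk : j ≤ k) p q (h : p ≤ q),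
    c i k (hij.trans hjk) p q h = c i j hij p q h + c j k hjk p q h

/-- Restriction of cells along a pair of monotone maps. -/
def Cell.pull {A : Type u} [AddCommGroup A] {a b a' b' : ℕ} (f : Fin (a' + 1) →o Fin (a + 1))
    (g : Fin (b' + 1) →o Fin (b + 1)) (y : Cell A a b) : Cell A a' b' where
  x i p q r h₁ h₂ := y.x (g i) (f p) (f q) (f r) (f.monotone h₁) (f.monotone h₂)
  c i j h p q h₁ := y.c (g i) (g j) (g.monotone h) (f p) (f q) (f.monotone h₁)
  x_left _ _ _ _ := y.x_left _ _ _ _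
  x_right _ _ _ _ := y.x_right _ _ _ _
  x_assoc _ _ _ _ _ _ _ _ := y.x_assoc _ _ _ _ _ _ _ _
  c_unit _ _ _ _ := y.c_unit _ _ _ _
  c_nat _ _ _ _ _ _ _ _ := y.c_nat _ _ _ _ _ _ _ _
  c_refl _ _ _ _ := y.c_refl _ _ _ _
  c_comp _ _ _ _ _ _ _ _ := y.c_comp _ _ _ _ _ _ _ _

/-- If the first map is constant, the restriction does not depend on the second one. -/
lemma Cell.pull_eq_of_const {A : Type u} [AddCommGroup A] {a b a' b' : ℕ}
    (f : Fin (a' + 1) →o Fin (a + 1)) (hf : ∀ p q, f p = f q)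
    (g g' : Fin (b' + 1) →o Fin (b + 1)) (y : Cell A a b) : y.pull f g = y.pull f g' := by
  have hx : ∀ i p q r (h₁ : p ≤ q) (h₂ : q ≤ r), p = q → y.x i p q r h₁ h₂ = 0 := by
    rintro i p q r h₁ h₂ rfl
    exact y.x_left _ _ _ _
  have hc : ∀ i j h p q (h₁ : p ≤ q), p = q → y.c i j h p q h₁ = 0 := by
    rintro i j h p q h₁ rfl
    exact y.c_unit _ _ _ _
  ext
  · exact (hx _ _ _ _ _ _ (hf _ _)).trans (hx _ _ _ _ _ _ (hf _ _)).symm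
  · exact (hc _ _ _ _ _ _ (hf _ _)).trans (hc _ _ _ _ _ _ (hf _ _)).symm

/-- The groupoid `𝐁² A`; its simplices depend only on the first two components of a generalized
simplex, so there are no nondegenerate ones of dimension `> 2`. The simplices all of whose
compositors `x` vanish (strict functors) form the strict 2-cat `B² A` inside `𝐁² A`. -/
def B2 (A : Type u) [AddCommGroup A] : GenSSet.{u} :=
  (ObjectProperty.ι _).op ⋙ (CategoryTheory.Quotient.lift degRel
    { obj := fun X => op (Cell A (X.obj 0).len (X.obj 1).len)
      map := fun f => Quiver.Hom.op
        (TypeCat.ofHom (Cell.pull (f.hom 0).toOrderHom (f.hom 1).toOrderHom)) }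
    (by
      rintro X Y f g ⟨d, hf, hg, h⟩
      refine congrArg (fun F => Quiver.Hom.op (TypeCat.ofHom F)) (funext fun y => ?_)
      have h0 := h 0 (Nat.zero_le _)
      rcases Nat.eq_zero_or_pos d with rfl | hd
      · rw [← h0]
        exact y.pull_eq_of_const _ ((isConst_iff _).1 hf.1) _ _
      · rw [h0, h 1 hd])).leftOp

/-- A cell on the shape `(Δ², Δ⁰)` is determined by the 2-morphism filling its nondegenerate
triangle `0 < 1 < 2`, which is arbitrary. -/
def Cell.equiv (A : Type u) [AddCommGroup A] : Cell A 2 0 ≃ A where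
  toFun y := y.x 0 0 1 2 (by decide) (by decide)
  invFun t :=
    { x := fun _ p q r _ _ => if p < q ∧ q < r then t else 0
      c := fun _ _ _ _ _ _ => 0
      x_left := by simp
      x_right := by simp
      x_assoc := by
        intro _ p q r s h₁ h₂ h₃
        split_ifs <;> first | (simp; done) | (exfalso; omega)
      c_unit := by simp
      c_nat := by
        intro i j
        simp
      c_refl := by simp
      c_comp := by simp }
  left_inv y := by
    refine Cell.ext ?_ ?_
    · funext i p q r h₁ h₂
      obtain rfl : i = 0 := Subsingleton.elim (α := Fin 1) _ _
      rcases h₁.eq_or_lt with rfl | h₁'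
      · simpa using! (y.x_left 0 _ _ h₂).symm
      rcases h₂.eq_or_lt with rfl | h₂'
      · simpa using! (y.x_right 0 _ _ h₁).symm
      obtain ⟨rfl, rfl, rfl⟩ : p = 0 ∧ q = 1 ∧ r = 2 :=
        ⟨Fin.ext (show p.val = 0 by omega), Fin.ext (show q.val = 1 by omega),
          Fin.ext (show r.val = 2 by omega)⟩
      simp
    · funext i j h p q h₁
      obtain rfl : i = j := Subsingleton.elim (α := Fin 1) _ _
      exact (y.c_refl _ _ _ _).symm
  right_inv t := by simp

/-- The identification `𝐁² A (⊵²) = A`. -/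
def B2.equiv (A : Type u) [AddCommGroup A] : (B2 A).obj (op (simplex 2)) ≃ A :=
  Cell.equiv A

/-- The normalized 2-cocycles `G × G → A` (for the trivial action of `G` on `A`). -/
def normalizedCocycles (G : Type u) [Group G] (A : Type u) [AddCommGroup A] :
    Set (G × G → A) :=
  {f | (∀ g h k : G, f (h, k) + f (g, h * k) = f (g * h, k) + f (g, h)) ∧
    (∀ g : G, f (1, g) = 0) ∧ ∀ g : G, f (g, 1) = 0}

end Cats

namespace Cats

open Simplicial

/-! Simplices of `B1 G` of shape `S` see only the first component `[a]` of `S`, so each is pulled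
back along the projection `S ⟶ simplex a`. Its image under a map `φ` is therefore pulled back from a
cell with `b = 0`, which forces every `c` to vanish and `x` not to depend on `i` (`app_c`, `app_x`).
Restricting further along a triangle `[2] → [a]` shows that each `x` is a value of `evalPair φ` on
two edges of the simplex. Hence `φ` is determined by `evalPair φ`, and the axioms on `x` for a
3-simplex and for degenerate triangles are the cocycle identity and normalization. Conversely, a
cocycle evaluated on edges, with `c = 0`, satisfies the cell axioms and is natural. -/

/-- The morphism of generalized simplices represented by a sequence of monotone maps. -/
def GenSimplex.homOf {S T : GenSimplex} (f : ∀ n, S.obj.as.obj n ⟶ T.obj.as.obj n) : S ⟶ T :=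
  ObjectProperty.homMk ((CategoryTheory.Quotient.functor degRel).map
    (X := S.obj.as) (Y := T.obj.as) (ObjectProperty.homMk f))

lemma GenSimplex.homOf_surjective {S T : GenSimplex} :
    Function.Surjective (GenSimplex.homOf (S := S) (T := T)) := by
  intro f
  obtain ⟨g, rfl⟩ := ObjectProperty.homMk_surjective f
  obtain ⟨h, rfl⟩ := (CategoryTheory.Quotient.functor degRel).map_surjective
    (X := S.obj.as) (Y := T.obj.as) g
  exact ⟨h.hom, rfl⟩

/-- The morphism of simplices given by a monotone map. -/
def GenSimplex.simplexMap {a b : ℕ} (f : ⦋a⦌ ⟶ ⦋b⦌) : simplex a ⟶ simplex b :=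
  GenSimplex.homOf fun n => match n with
    | 0 => f
    | _ + 1 => 𝟙 ⦋0⦌

/-- The projection of `S` onto its first component. -/
def GenSimplex.toSimplex (S : GenSimplex) : S ⟶ simplex (S.obj.as.obj 0).len :=
  GenSimplex.homOf fun n => match n with
    | 0 => 𝟙 (S.obj.as.obj 0)
    | _ + 1 => SimplexCategory.const _ ⦋0⦌ 0

/-- The monotone map `[2] → [a]` with values `p ≤ q ≤ r`. -/
def triangleMap {a : ℕ} {p q r : Fin (a + 1)} (h₁ : p ≤ q) (h₂ : q ≤ r) : ⦋2⦌ ⟶ ⦋a⦌ :=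
  SimplexCategory.mkHom
    { toFun := ![p, q, r]
      monotone' := by
        rw [Fin.monotone_iff_le_succ]
        intro i
        fin_cases i
        exacts [h₁, h₂] }

section Edge

variable {G : Type u} [Group G]

/-- The edge from vertex `p` to vertex `q` of a simplex of `𝐁¹ G`. -/
def B1.edge {S : GenSimplex} (σ : (B1 G).obj (op S)) {p q : Fin ((S.obj.as.obj 0).len + 1)}
    (h : p ≤ q) : G :=
  CategoryTheory.Functor.map (C := Fin ((S.obj.as.obj 0).len + 1)) (D := SingleObj G) σ (homOfLE h)

lemma B1.edge_self {S : GenSimplex} (σ : (B1 G).obj (op S)) (p) :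
    B1.edge σ (le_refl p) = 1 :=
  CategoryTheory.Functor.map_id (C := Fin ((S.obj.as.obj 0).len + 1)) (D := SingleObj G) σ p

lemma B1.edge_trans {S : GenSimplex} (σ : (B1 G).obj (op S))
    {p q r : Fin ((S.obj.as.obj 0).len + 1)} (h₁ : p ≤ q) (h₂ : q ≤ r) :
    B1.edge σ (h₁.trans h₂) = B1.edge σ h₂ * B1.edge σ h₁ :=
  CategoryTheory.Functor.map_comp (C := Fin ((S.obj.as.obj 0).len + 1)) (D := SingleObj G) σ
    (homOfLE h₁) (homOfLE h₂)

/-- A 2-simplex of a nerve is determined by its two consecutive edges. -/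
lemma B1.map_simplexMap_triangleMap {a : ℕ} (σ : (B1 G).obj (op (simplex a)))
    {p q r : Fin (a + 1)} (h₁ : p ≤ q) (h₂ : q ≤ r) :
    (B1 G).map (GenSimplex.simplexMap (triangleMap h₁ h₂)).op σ =
      B1.pair (B1.edge σ h₂) (B1.edge σ h₁) :=
  ComposableArrows.ext₂ rfl rfl rfl
    ((Category.id_comp _).trans (Category.comp_id _)).symm
    ((Category.id_comp _).trans (Category.comp_id _)).symm


end Edge

section Evaluation

variable {G : Type u} [Group G] {A : Type u} [AddCommGroup A]

/-- The function on pairs given by evaluation at the 2-simplices of `𝐁¹ G`. -/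
def evalPair (φ : B1 G ⟶ B2 A) (gh : G × G) : A :=
  B2.equiv A (φ.app (op (simplex 2)) (B1.pair gh.1 gh.2))

/-- Naturality along `S.toSimplex`. Its first component is the identity, so `σ` itself serves as the
simplex of shape `simplex a`. -/
lemma app_eq_pull (φ : B1 G ⟶ B2 A) {S : GenSimplex} (σ : (B1 G).obj (op S)) :
    φ.app (op S) σ = Cell.pull OrderHom.id
        (SimplexCategory.const (S.obj.as.obj 1) ⦋0⦌ 0).toOrderHom
      (φ.app (op (simplex (S.obj.as.obj 0).len)) σ) :=
  NatTrans.naturality_apply φ S.toSimplex.op σ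

lemma app_c (φ : B1 G ⟶ B2 A) {S : GenSimplex} (σ : (B1 G).obj (op S)) (i j h p q h₁) :
    Cell.c (a := (S.obj.as.obj 0).len) (b := (S.obj.as.obj 1).len) (φ.app (op S) σ) i j h p q h₁ =
      0 := by
  rw [app_eq_pull]
  -- After the pullback both indices are `0`, so `c` belongs to an identity transformation.
  exact Cell.c_refl (b := 0) _ _ _ _ _

lemma app_x (φ : B1 G ⟶ B2 A) {S : GenSimplex} (σ : (B1 G).obj (op S)) (i p q r h₁ h₂) :
    Cell.x (a := (S.obj.as.obj 0).len) (b := (S.obj.as.obj 1).len) (φ.app (op S) σ) i p q r h₁ h₂ =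
      evalPair φ (B1.edge σ h₂, B1.edge σ h₁) := by
  have h := NatTrans.naturality_apply φ
    (GenSimplex.simplexMap (triangleMap h₁ h₂)).op σ
  rw [app_eq_pull]
  exact (congrArg (B2.equiv A) h).symm.trans (congrArg (fun τ => B2.equiv A (φ.app _ τ))
    (B1.map_simplexMap_triangleMap (a := (S.obj.as.obj 0).len) σ h₁ h₂))

lemma evalPair_injective :
    Function.Injective (evalPair : (B1 G ⟶ B2 A) → G × G → A) := by
  intro φ ψ h
  ext S σ
  refine Cell.ext ?_ ?_
  · funext i p q r h₁ h₂
    exact (app_x φ σ ..).trans ((congrFun h _).trans (app_x ψ σ ..).symm)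
  · funext i j h p q h₁
    exact (app_c φ σ ..).trans (app_c ψ σ ..).symm

lemma evalPair_mem (φ : B1 G ⟶ B2 A) : evalPair φ ∈ normalizedCocycles G A := by
  refine ⟨fun g h k => ?_, fun g => ?_, fun g => ?_⟩
  -- With consecutive edges `k`, `h`, `g`, the faces 023, 012, 013, 123 give `(g, h * k)`, `(h, k)`,
  -- `(g * h, k)`, `(g, h)`.
  · let σ : (B1 G).obj (op (simplex 3)) :=
      ComposableArrows.mk₃ (C := SingleObj G) (X₀ := SingleObj.star G) (X₁ := SingleObj.star G)
        (X₂ := SingleObj.star G) (X₃ := SingleObj.star G) k h g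
    have e := Cell.x_assoc (a := 3) (b := 0) (φ.app (op (simplex 3)) σ) 0 0 1 2 3
      (by decide) (by decide) (by decide)
    rw [add_comm]
    refine Eq.trans ?_ (e.symm.trans ?_)
    · exact congrArg₂ (· + ·) (app_x φ σ 0 0 2 3 _ _).symm (app_x φ σ 0 0 1 2 _ _).symm
    · exact congrArg₂ (· + ·) (app_x φ σ 0 0 1 3 _ _) (app_x φ σ 0 1 2 3 _ _)
  -- The degenerate triangle 011 has edges `g`, then `1`; below, 001 has `1`, then `g`.
  · exact (app_x φ (B1.pair 1 g) 0 (0 : Fin 3) (1 : Fin 3) (1 : Fin 3) (by decide)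
      le_rfl).symm.trans
      (Cell.x_right (a := 2) (b := 0) (φ.app (op (simplex 2)) (B1.pair 1 g)) 0 0 1 (by decide))
  · exact (app_x φ (B1.pair 1 g) 0 (0 : Fin 3) (0 : Fin 3) (1 : Fin 3)
      le_rfl (by decide)).symm.trans
      (Cell.x_left (a := 2) (b := 0) (φ.app (op (simplex 2)) (B1.pair 1 g)) 0 0 1 (by decide))

/-- The cell with the given compositors on the edges of a simplex. -/
def cellOfCocycle {f : G × G → A} (hf : f ∈ normalizedCocycles G A) {S : GenSimplex}
    (σ : (B1 G).obj (op S)) : Cell A (S.obj.as.obj 0).len (S.obj.as.obj 1).len where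
  x _ _ _ _ h₁ h₂ := f (B1.edge σ h₂, B1.edge σ h₁)
  c _ _ _ _ _ _ := 0
  x_left _ _ _ _ := by rw [B1.edge_self]; exact hf.2.2 _
  x_right _ _ _ _ := by rw [B1.edge_self]; exact hf.2.1 _
  x_assoc _ _ _ _ _ h₁ h₂ h₃ := by
    rw [B1.edge_trans σ h₂ h₃, B1.edge_trans σ h₁ h₂, ← hf.1, add_comm]
  c_unit _ _ _ _ := rfl
  c_nat _ _ _ _ _ _ _ _ := by simp
  c_refl _ _ _ _ := rfl
  c_comp _ _ _ _ _ _ _ _ := by simp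

/-- The map `𝐁¹ G ⟶ 𝐁² A` given by a normalized cocycle. -/
def homOfCocycle {f : G × G → A} (hf : f ∈ normalizedCocycles G A) : B1 G ⟶ B2 A where
  app S := TypeCat.ofHom fun σ => cellOfCocycle hf (S := S.unop) σ
  naturality S T g := by
    -- For a morphism given by a representative, both presheaves act by reindexing vertices, so
    -- naturality becomes definitional.
    obtain ⟨h, hg⟩ := GenSimplex.homOf_surjective g.unop
    obtain rfl : (GenSimplex.homOf h).op = g := congrArg Quiver.Hom.op hg
    rfl

lemma evalPair_homOfCocycle {f : G × G → A} (hf : f ∈ normalizedCocycles G A) :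
    evalPair (homOfCocycle hf) = f := rfl

end Evaluation

end Cats

/-- Evaluation of maps `𝐁¹ G ⟶ 𝐁² A` on the 2-simplices of `𝐁¹ G` is a bijection onto the
normalized 2-cocycles. -/
theorem mainTheorem7 (G : Type u) [Group G] (A : Type u) [AddCommGroup A] :
    Set.BijOn
      (fun (φ : Cats.B1 G ⟶ Cats.B2 A) (gh : G × G) =>
        Cats.B2.equiv A (φ.app (op (Cats.simplex 2)) (Cats.B1.pair gh.1 gh.2)))
      Set.univ (Cats.normalizedCocycles G A) :=
  ⟨fun φ _ => Cats.evalPair_mem φ, Cats.evalPair_injective.injOn,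
    fun _ hf => ⟨Cats.homOfCocycle hf, trivial, Cats.evalPair_homOfCocycle hf⟩⟩
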